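/- Let $\mathbb K$ be $\mathbb R$ or $\mathbb C$ and let $\ell_2$ be the space of square-summable sequences in $\mathbb K$. A bounded linear operator $T:H_1\to H_2$ between Hilbert spaces over $\mathbb K$ is called a Hilbert–Schmidt map if $\sum_{i}\|T e_i\|^2<\infty$ for an (equivalently, every) orthonormal basis $(e_i)$ of $H_1$. A Banach space $X$ over $\mathbb K$ is called a Hilbert–Schmidt space if for all Hilbert spaces $H_1,H_2$ over $\mathbb K$, every bounded linear operator $T:H_1\to H_2$ that factors over $X$ (that is, $T=BA$ for some bounded linear maps $A:H_1\to X$ and $B:X\to H_2$) is a Hilbert–Schmidt map. Theorem 3.13. For a Banach space $X$ over $\mathbb K$, the following are equivalent: (i) $X$ is a Hilbert–Schmidt space. (ii) For every bounded linear map $T:X\to\ell_2$, every Banach space $Y$ over $\mathbb K$ and every linear isometric embedding $j:X\to Y$, there is a bounded linear map $S:Y\to\ell_2$ with $S\circ j=T$. -/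

import Mathlib

universe u v w t

/-- A bounded linear operator `T` between Hilbert spaces is *Hilbert–Schmidt* if
`∑ i, ‖T (b i)‖ ^ 2 < ∞` for an orthonormal basis `b` of its domain. Every Hilbert space has an
orthonormal basis and the value of the sum does not depend on it, so that we may ask this for
every orthonormal basis. A basis can always be reindexed by a type in the universe of the space. -/
def IsHilbertSchmidtMap {𝕜 : Type} [RCLike 𝕜] {H₁ : Type v} {H₂ : Type w}
    [NormedAddCommGroup H₁] [InnerProductSpace 𝕜 H₁]
    [NormedAddCommGroup H₂] [InnerProductSpace 𝕜 H₂] (T : H₁ →L[𝕜] H₂) : Prop :=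
  ∀ (ι : Type v) (b : HilbertBasis ι 𝕜 H₁), Summable fun i => ‖T (b i)‖ ^ 2

/-- `T : E → F` *factors over* `X` if `T = B ∘ A` with bounded linear maps `A : E → X` and
`B : X → F`. -/
def FactorsOver {𝕜 : Type} [RCLike 𝕜] (X : Type u) [NormedAddCommGroup X] [NormedSpace 𝕜 X]
    {E : Type v} {F : Type w} [NormedAddCommGroup E] [NormedSpace 𝕜 E]
    [NormedAddCommGroup F] [NormedSpace 𝕜 F] (T : E →L[𝕜] F) : Prop :=
  ∃ (A : E →L[𝕜] X) (B : X →L[𝕜] F), T = B.comp A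

/-- `X` is a *Hilbert–Schmidt space* if each bounded linear operator acting between Hilbert spaces
and factoring over `X` is a Hilbert–Schmidt map. -/
def IsHilbertSchmidtSpace (𝕜 : Type) [RCLike 𝕜] (X : Type u)
    [NormedAddCommGroup X] [NormedSpace 𝕜 X] : Prop :=
  ∀ (H₁ : Type v) (H₂ : Type w)
    [NormedAddCommGroup H₁] [InnerProductSpace 𝕜 H₁] [CompleteSpace H₁]
    [NormedAddCommGroup H₂] [InnerProductSpace 𝕜 H₂] [CompleteSpace H₂]
    (T : H₁ →L[𝕜] H₂), FactorsOver X T → IsHilbertSchmidtMap T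

/-- Every bounded linear map `T : X → F` extends to a bounded linear map on every Banach
superspace of `X`, i.e. on every Banach space `Y` with a linear isometric embedding `j : X → Y`. -/
def ExtendsToSuperspaces (𝕜 : Type) [RCLike 𝕜] (X : Type u)
    [NormedAddCommGroup X] [NormedSpace 𝕜 X]
    (F : Type w) [NormedAddCommGroup F] [NormedSpace 𝕜 F] : Prop :=
  ∀ (T : X →L[𝕜] F) (Y : Type (max u t)) [NormedAddCommGroup Y] [NormedSpace 𝕜 Y]
    [CompleteSpace Y] (j : X →ₗᵢ[𝕜] Y), ∃ S : Y →L[𝕜] F, ∀ x : X, S (j x) = T x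

/-!
Both properties of `X` say that every operator `T : X → ℓ₂` is two-summing.

If `X` is a Hilbert–Schmidt space, `T ∘ A` is Hilbert–Schmidt for each bounded `A` from a Hilbert
space to `X`, and the uniform boundedness principle turns this into a two-summing constant for `T`
(`IsHilbertSchmidtSpace.exists_isTwoSumming`). Let `X` be contained in `Y`. By Pietsch's argument, a
positive normalized functional `μ` on the bounded functions on the dual ball of `Y` satisfies
`‖T x‖ ^ 2 ≤ C * μ (φ ↦ ‖φ x‖ ^ 2)` (`IsTwoSumming.exists_positive_functional`). The right-hand side
is a continuous Hilbertian seminorm on all of `Y`, so that `T` factors through a subspace of a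
Hilbert space to which `Y` maps, and an orthogonal projection extends it
(`IsTwoSumming.exists_extension`).

Conversely, embed `X` isometrically into some `ℓ∞(Γ)` and extend `T` to it. The little Grothendieck
theorem (`isTwoSummingBound_linfty`) bounds Hilbert–Schmidt sums of operators factoring over
`ℓ∞(Γ)`. It is proved by cutting off random signed sums: this improves a given two-summing bound `C`
to `24 * ‖B‖ ^ 2 + C / 2`, hence in the limit to `48 * ‖B‖ ^ 2`. An operator into an arbitrary
Hilbert space reduces to one into `ℓ₂`, because countably many vectors suffice to detect that a sum
diverges (`exists_continuousLinearMap_lp_nat`).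
-/

/-! ### Moments of signed sums -/

/-- The sum of `±v i` over `i ∈ s`, the signs being given by `ω`: `true` stands for `+`. Averages
over independent uniform signs are finite sums over `ω : ι → Bool`. -/
def signedSum {ι V : Type*} [AddCommGroup V] (s : Finset ι) (v : ι → V) (ω : ι → Bool) : V :=
  ∑ i ∈ s, if ω i then v i else -v i

/-- Flipping the `j`-th sign is a bijection of the sign patterns that leaves the sum over `s`
unchanged, so that one sign can be averaged out exactly. -/
theorem sum_signedSum_insert {ι V : Type*} [Fintype ι] [DecidableEq ι] [AddCommGroup V]
    (F : V → ℝ) (v : ι → V) {s : Finset ι} {j : ι} (hj : j ∉ s) :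
    2 * ∑ ω, F (signedSum (insert j s) v ω) =
      ∑ ω, (F (signedSum s v ω + v j) + F (signedSum s v ω - v j)) := by
  let e : (ι → Bool) ≃ (ι → Bool) :=
    Function.Involutive.toPerm (fun ω => Function.update ω j (!ω j)) (by
      intro ω
      ext i
      by_cases h : i = j
      · subst h; simp
      · simp [h])
  have hea : ∀ ω, e ω = Function.update ω j (!ω j) := fun _ => rfl
  have he : ∀ ω, signedSum s v (e ω) = signedSum s v ω := by
    intro ω
    refine Finset.sum_congr rfl fun i hi => ?_
    have : i ≠ j := fun h => hj (h ▸ hi)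
    simp [hea, this]
  have hej : ∀ ω, e ω j = !ω j := fun ω => by simp [hea]
  have hins : ∀ ω, signedSum (insert j s) v ω =
      (if ω j then v j else -v j) + signedSum s v ω := fun ω => Finset.sum_insert hj
  rw [two_mul]
  conv_lhs => arg 2; rw [← Equiv.sum_comp e]
  rw [← Finset.sum_add_distrib]
  refine Finset.sum_congr rfl fun ω _ => ?_
  rw [hins, hins, he, hej]
  cases ω j
  · simp [add_comm, sub_eq_add_neg]
  · simp [add_comm, sub_eq_add_neg]

theorem sum_norm_sq_signedSum {ι V : Type*} (𝕜 : Type*) [RCLike 𝕜] [Fintype ι] [DecidableEq ι]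
    [NormedAddCommGroup V] [InnerProductSpace 𝕜 V] (v : ι → V) (s : Finset ι) :
    ∑ ω, ‖signedSum s v ω‖ ^ 2 = Fintype.card (ι → Bool) * ∑ i ∈ s, ‖v i‖ ^ 2 := by
  induction s using Finset.induction_on with
  | empty => simp [signedSum]
  | insert j s hj ih =>
    have h := sum_signedSum_insert (fun x : V => ‖x‖ ^ 2) v hj
    have hp : ∀ ω, ‖signedSum s v ω + v j‖ ^ 2 + ‖signedSum s v ω - v j‖ ^ 2 =
        2 * ‖signedSum s v ω‖ ^ 2 + 2 * ‖v j‖ ^ 2 := fun ω => by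
      have := parallelogram_law_with_norm 𝕜 (signedSum s v ω) (v j)
      linarith
    simp only [hp] at h
    rw [Finset.sum_add_distrib, ← Finset.mul_sum, ih] at h
    simp only [Finset.sum_const, Finset.card_univ, nsmul_eq_mul] at h
    rw [Finset.sum_insert hj]
    linarith

theorem norm_add_pow_four_add_norm_sub_pow_four_le {V : Type*} (𝕜 : Type*) [RCLike 𝕜]
    [NormedAddCommGroup V] [InnerProductSpace 𝕜 V] (a b : V) :
    ‖a + b‖ ^ 4 + ‖a - b‖ ^ 4 ≤ 2 * ‖a‖ ^ 4 + 12 * ‖a‖ ^ 2 * ‖b‖ ^ 2 + 2 * ‖b‖ ^ 4 := by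
  have h1 := norm_add_sq (𝕜 := 𝕜) a b
  have h2 := norm_sub_sq (𝕜 := 𝕜) a b
  have h3 : RCLike.re (inner 𝕜 a b) ^ 2 ≤ ‖a‖ ^ 2 * ‖b‖ ^ 2 := by
    rw [← mul_pow]
    exact sq_le_sq' (neg_le_of_abs_le ((RCLike.abs_re_le_norm _).trans (norm_inner_le_norm a b)))
      (re_inner_le_norm a b)
  have e1 : ‖a + b‖ ^ 4 = (‖a + b‖ ^ 2) ^ 2 := by ring
  have e2 : ‖a - b‖ ^ 4 = (‖a - b‖ ^ 2) ^ 2 := by ring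
  rw [e1, e2, h1, h2]
  nlinarith

theorem sum_norm_pow_four_signedSum_le {ι V : Type*} (𝕜 : Type*) [RCLike 𝕜] [Fintype ι] [DecidableEq ι]
    [NormedAddCommGroup V] [InnerProductSpace 𝕜 V] (v : ι → V) (s : Finset ι) :
    ∑ ω, ‖signedSum s v ω‖ ^ 4 ≤
      Fintype.card (ι → Bool) * (3 * (∑ i ∈ s, ‖v i‖ ^ 2) ^ 2) := by
  induction s using Finset.induction_on with
  | empty => simp [signedSum]
  | insert j s hj ih =>
    have h := sum_signedSum_insert (fun x : V => ‖x‖ ^ 4) v hj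
    have hp := Finset.sum_le_sum fun ω (_ : ω ∈ Finset.univ) =>
      norm_add_pow_four_add_norm_sub_pow_four_le 𝕜 (signedSum s v ω) (v j)
    rw [← h, Finset.sum_add_distrib, Finset.sum_add_distrib, ← Finset.sum_mul, ← Finset.mul_sum,
      ← Finset.mul_sum, sum_norm_sq_signedSum 𝕜] at hp
    simp only [Finset.sum_const, Finset.card_univ, nsmul_eq_mul] at hp
    rw [Finset.sum_insert hj]
    have : (0 : ℝ) ≤ Fintype.card (ι → Bool) * ‖v j‖ ^ 4 := by positivity
    nlinarith

/-- A sequence that defines a bounded map out of `ℓ₂` is weakly square-summable. The test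
coefficients `conj (φ (f i))` turn the weak sum into a value of `φ`. -/
theorem sum_norm_sq_apply_le {𝕜 E ι : Type*} [RCLike 𝕜] [SeminormedAddCommGroup E]
    [NormedSpace 𝕜 E] (s : Finset ι) (f : ι → E) {K : ℝ} (hK : 0 ≤ K)
    (hf : ∀ a : ι → 𝕜, ‖∑ i ∈ s, a i • f i‖ ^ 2 ≤ K * ∑ i ∈ s, ‖a i‖ ^ 2) (φ : E →L[𝕜] 𝕜) :
    ∑ i ∈ s, ‖φ (f i)‖ ^ 2 ≤ ‖φ‖ ^ 2 * K := by
  set Q := ∑ i ∈ s, ‖φ (f i)‖ ^ 2 with hQ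
  have hQ0 : 0 ≤ Q := by positivity
  have h1 : φ (∑ i ∈ s, (starRingEnd 𝕜) (φ (f i)) • f i) = (Q : 𝕜) := by
    simp [hQ, RCLike.conj_mul]
  have h2 : Q ≤ ‖φ‖ * ‖∑ i ∈ s, (starRingEnd 𝕜) (φ (f i)) • f i‖ := by
    have := φ.le_opNorm (∑ i ∈ s, (starRingEnd 𝕜) (φ (f i)) • f i)
    rwa [h1, RCLike.norm_ofReal, abs_of_nonneg hQ0] at this
  have h3 := hf fun i => (starRingEnd 𝕜) (φ (f i))
  simp only [RCLike.norm_conj] at h3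
  rw [← hQ] at h3
  have h4 : Q ^ 2 ≤ ‖φ‖ ^ 2 * K * Q := by
    calc Q ^ 2 ≤ (‖φ‖ * ‖∑ i ∈ s, (starRingEnd 𝕜) (φ (f i)) • f i‖) ^ 2 := by gcongr
      _ ≤ ‖φ‖ ^ 2 * (K * Q) := by rw [mul_pow]; gcongr
      _ = _ := by ring
  rcases hQ0.eq_or_lt with h | h
  · rw [← h]; positivity
  · nlinarith

theorem norm_sum_mul_sq_le {𝕜 ι : Type*} [RCLike 𝕜] (s : Finset ι) (a b : ι → 𝕜) {K : ℝ}
    (hb : ∑ i ∈ s, ‖b i‖ ^ 2 ≤ K) : ‖∑ i ∈ s, a i * b i‖ ^ 2 ≤ K * ∑ i ∈ s, ‖a i‖ ^ 2 :=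
  calc ‖∑ i ∈ s, a i * b i‖ ^ 2 ≤ (∑ i ∈ s, ‖a i‖ * ‖b i‖) ^ 2 := by
        gcongr
        exact (norm_sum_le _ _).trans_eq (by simp)
    _ ≤ (∑ i ∈ s, ‖a i‖ ^ 2) * ∑ i ∈ s, ‖b i‖ ^ 2 := Finset.sum_mul_sq_le_sq_mul_sq _ _ _
    _ ≤ (∑ i ∈ s, ‖a i‖ ^ 2) * K := by gcongr
    _ = _ := mul_comm _ _

theorem norm_sum_smul_sq_le_of_pointwise {𝕜 Γ ι : Type*} [RCLike 𝕜] (s : Finset ι)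
    (f : ι → lp (fun _ : Γ => 𝕜) ⊤) {K : ℝ} (hK : 0 ≤ K)
    (hf : ∀ γ, ∑ i ∈ s, ‖f i γ‖ ^ 2 ≤ K) (a : ι → 𝕜) :
    ‖∑ i ∈ s, a i • f i‖ ^ 2 ≤ K * ∑ i ∈ s, ‖a i‖ ^ 2 := by
  have h0 : 0 ≤ K * ∑ i ∈ s, ‖a i‖ ^ 2 := by positivity
  rw [← Real.le_sqrt (norm_nonneg _) h0]
  refine lp.norm_le_of_forall_le (Real.sqrt_nonneg _) fun γ => ?_
  rw [Real.le_sqrt (norm_nonneg _) h0]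
  have e : (∑ i ∈ s, a i • f i : lp (fun _ : Γ => 𝕜) ⊤) γ = ∑ i ∈ s, a i * f i γ := by
    rw [lp.coeFn_sum, Finset.sum_apply]
    rfl
  rw [e]
  exact norm_sum_mul_sq_le s a (fun i => f i γ) (hf γ)

/-! ### Grothendieck's inequality for operators from bounded functions to a Hilbert space -/

/-- `C` bounds the square of the two-summing norm of an operator `B` on `ℓ∞(Γ)`. The weak
`ℓ₂`-norm of a finite family of bounded functions is expressed by pointwise sums of squares, and it
is normalized to be at most `1`. -/
def IsTwoSummingBound {𝕜 Γ H : Type*} [RCLike 𝕜] [NormedAddCommGroup H] [NormedSpace 𝕜 H]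
    (B : lp (fun _ : Γ => 𝕜) ⊤ →L[𝕜] H) (C : ℝ) : Prop :=
  ∀ (ι : Type) [Fintype ι] (f : ι → lp (fun _ : Γ => 𝕜) ⊤),
    (∀ γ, ∑ i, ‖f i γ‖ ^ 2 ≤ 1) → ∑ i, ‖B (f i)‖ ^ 2 ≤ C

/-- An operator of finite rank is two-summing: each of its coordinates is a functional. The
constant depends on the rank and serves only to start `IsTwoSummingBound.improve`. -/
theorem isTwoSummingBound_of_finiteDimensional {𝕜 Γ H : Type*} [RCLike 𝕜]
    [NormedAddCommGroup H] [InnerProductSpace 𝕜 H] [FiniteDimensional 𝕜 H]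
    (B : lp (fun _ : Γ => 𝕜) ⊤ →L[𝕜] H) : ∃ C, IsTwoSummingBound B C := by
  let b := stdOrthonormalBasis 𝕜 H
  refine ⟨∑ k, ‖(innerSL 𝕜 (b k)).comp B‖ ^ 2, fun ι _ f hf => ?_⟩
  calc ∑ i, ‖B (f i)‖ ^ 2 = ∑ i, ∑ k, ‖((innerSL 𝕜 (b k)).comp B) (f i)‖ ^ 2 := by
        refine Finset.sum_congr rfl fun i _ => ?_
        rw [← b.sum_sq_norm_inner_right]
        rfl
    _ = ∑ k, ∑ i, ‖((innerSL 𝕜 (b k)).comp B) (f i)‖ ^ 2 := Finset.sum_comm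
    _ ≤ _ := Finset.sum_le_sum fun k _ => by
        simpa using sum_norm_sq_apply_le Finset.univ f zero_le_one
          (norm_sum_smul_sq_le_of_pointwise Finset.univ f zero_le_one hf)
          ((innerSL 𝕜 (b k)).comp B)

/-- Self-improvement of two-summing bounds. Given `f`, let `h` be the random signed sum of the
`f i`. The mean of `‖B h‖ ^ 2` is the sum to be bounded. Cut `h` off where `‖h γ‖ ^ 2 > 12`: the
bounded part costs `‖B‖`, while the rest has mean square at most `1 / 4` at each point by the fourth
moment bound, so that `C` applies to it as a family indexed by the signs. -/
theorem IsTwoSummingBound.improve {𝕜 Γ H : Type*} [RCLike 𝕜]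
    [NormedAddCommGroup H] [InnerProductSpace 𝕜 H]
    {B : lp (fun _ : Γ => 𝕜) ⊤ →L[𝕜] H} {C : ℝ} (hC : IsTwoSummingBound B C) :
    IsTwoSummingBound B (24 * ‖B‖ ^ 2 + C / 2) := by
  classical
  intro ι _ f hf
  set N : ℝ := (Fintype.card (ι → Bool) : ℝ) with hN
  have hN0 : 0 < N := by positivity
  let h : (ι → Bool) → lp (fun _ : Γ => 𝕜) ⊤ := fun ω => signedSum Finset.univ f ω
  have hγ : ∀ ω γ, h ω γ = signedSum Finset.univ (fun i => f i γ) ω := by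
    intro ω γ
    simp only [h, signedSum]
    rw [lp.coeFn_sum, Finset.sum_apply]
    refine Finset.sum_congr rfl fun i _ => ?_
    split_ifs <;> rfl
  let g : (ι → Bool) → lp (fun _ : Γ => 𝕜) ⊤ := fun ω =>
    ⟨fun γ => if ‖h ω γ‖ ^ 2 ≤ 12 then h ω γ else 0, memℓp_infty ⟨‖h ω‖, by
      rintro _ ⟨γ, rfl⟩
      dsimp only
      split_ifs
      · exact lp.norm_apply_le_norm (by simp) _ _
      · simp⟩⟩
  have hgγ : ∀ ω γ, g ω γ = if ‖h ω γ‖ ^ 2 ≤ 12 then h ω γ else 0 := fun _ _ => rfl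
  have hg : ∀ ω, ‖B (g ω)‖ ^ 2 ≤ 12 * ‖B‖ ^ 2 := by
    intro ω
    have h1 : ‖g ω‖ ≤ √12 := by
      refine lp.norm_le_of_forall_le (Real.sqrt_nonneg _) fun γ => ?_
      rw [hgγ]
      split_ifs with hc
      · exact Real.le_sqrt_of_sq_le hc
      · simp
    calc ‖B (g ω)‖ ^ 2 ≤ (‖B‖ * √12) ^ 2 := by
          gcongr
          exact B.le_of_opNorm_le_of_le le_rfl h1
      _ = _ := by rw [mul_pow, Real.sq_sqrt (by norm_num)]; ring
  -- The factor `1 / √N` makes sums over `ω` into means, and `2` undoes the mean square `1 / 4`.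
  let c : 𝕜 := ((2 / √N : ℝ) : 𝕜)
  have hc : ‖c‖ ^ 2 = 4 / N := by
    rw [RCLike.norm_ofReal, sq_abs, div_pow, Real.sq_sqrt hN0.le]
    norm_num
  have hr := hC (ι → Bool) (fun ω => c • (h ω - g ω)) (fun γ => by
    have h4 := sum_norm_pow_four_signedSum_le 𝕜 (fun i => f i γ) Finset.univ
    simp only [← hγ, ← hN] at h4
    have hpt : ∀ ω, ‖(c • (h ω - g ω) : lp (fun _ : Γ => 𝕜) ⊤) γ‖ ^ 2
        ≤ (1 / (3 * N)) * ‖h ω γ‖ ^ 4 := by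
      intro ω
      have e : (c • (h ω - g ω) : lp (fun _ : Γ => 𝕜) ⊤) γ = c * (h ω γ - g ω γ) := rfl
      rw [e, norm_mul, mul_pow, hc, hgγ]
      split_ifs with hc'
      · simp; positivity
      · push Not at hc'
        rw [sub_zero]
        have : (1 / (3 * N)) * ‖h ω γ‖ ^ 4 - 4 / N * ‖h ω γ‖ ^ 2
            = (1 / (3 * N)) * ‖h ω γ‖ ^ 2 * (‖h ω γ‖ ^ 2 - 12) := by
          field_simp
          ring
        have h2 : 0 ≤ (1 / (3 * N)) * ‖h ω γ‖ ^ 2 * (‖h ω γ‖ ^ 2 - 12) :=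
          mul_nonneg (by positivity) (by linarith)
        linarith
    have hs : (∑ i, ‖f i γ‖ ^ 2) ^ 2 ≤ 1 := pow_le_one₀ (by positivity) (hf γ)
    calc _ ≤ ∑ ω, (1 / (3 * N)) * ‖h ω γ‖ ^ 4 := Finset.sum_le_sum fun ω _ => hpt ω
      _ = (1 / (3 * N)) * ∑ ω, ‖h ω γ‖ ^ 4 := by rw [Finset.mul_sum]
      _ ≤ (1 / (3 * N)) * (N * (3 * 1)) := by
        gcongr
        exact h4.trans (by gcongr)
      _ = 1 := by field_simp)
  have hr' : 4 / N * ∑ ω, ‖B (h ω - g ω)‖ ^ 2 ≤ C := by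
    simpa only [map_smul, norm_smul, mul_pow, hc, ← Finset.mul_sum] using hr
  have h2 := sum_norm_sq_signedSum 𝕜 (fun i => B (f i)) Finset.univ
  have hB : ∀ ω, signedSum Finset.univ (fun i => B (f i)) ω = B (h ω) := by
    intro ω
    simp only [h, signedSum, map_sum]
    refine Finset.sum_congr rfl fun i _ => ?_
    split_ifs <;> simp
  simp only [hB, ← hN] at h2
  have h3 : ∑ ω, ‖B (h ω)‖ ^ 2 ≤ N * (24 * ‖B‖ ^ 2) + 2 * ∑ ω, ‖B (h ω - g ω)‖ ^ 2 := by
    have hpt : ∀ ω, ‖B (h ω)‖ ^ 2 ≤ 24 * ‖B‖ ^ 2 + 2 * ‖B (h ω - g ω)‖ ^ 2 := by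
      intro ω
      have e : B (h ω) = B (g ω) + B (h ω - g ω) := by rw [← map_add]; congr 1; abel
      have h5 : ‖B (h ω)‖ ^ 2 ≤ (‖B (g ω)‖ + ‖B (h ω - g ω)‖) ^ 2 := by
        rw [e]; gcongr; exact norm_add_le _ _
      nlinarith [hg ω, sq_nonneg (‖B (g ω)‖ - ‖B (h ω - g ω)‖)]
    refine (Finset.sum_le_sum fun ω _ => hpt ω).trans_eq ?_
    rw [Finset.sum_add_distrib, Finset.sum_const, Finset.card_univ, nsmul_eq_mul, ← hN,
      ← Finset.mul_sum]
  have h6 : ∑ ω, ‖B (h ω - g ω)‖ ^ 2 ≤ N * C / 4 := by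
    rw [div_mul_eq_mul_div, div_le_iff₀ hN0] at hr'
    linarith
  have h7 : N * ∑ i, ‖B (f i)‖ ^ 2 ≤ N * (24 * ‖B‖ ^ 2 + C / 2) := by
    linarith
  exact le_of_mul_le_mul_left h7 hN0

/-- The fixed point of `C ↦ 24 * ‖B‖ ^ 2 + C / 2` is `48 * ‖B‖ ^ 2`, and iteration converges to it. -/
theorem isTwoSummingBound_of_exists {𝕜 Γ H : Type*} [RCLike 𝕜]
    [NormedAddCommGroup H] [InnerProductSpace 𝕜 H]
    {B : lp (fun _ : Γ => 𝕜) ⊤ →L[𝕜] H} (hB : ∃ C, IsTwoSummingBound B C) :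
    IsTwoSummingBound B (48 * ‖B‖ ^ 2) := by
  obtain ⟨C, hC⟩ := hB
  have hn : ∀ n : ℕ, IsTwoSummingBound B (48 * ‖B‖ ^ 2 + C * (1 / 2) ^ n) := by
    intro n
    induction n with
    | zero =>
      intro ι _ f hf
      have := hC ι f hf
      nlinarith [sq_nonneg ‖B‖]
    | succ n ih =>
      convert ih.improve using 1
      ring
  intro ι _ f hf
  have hl : Filter.Tendsto (fun n : ℕ => 48 * ‖B‖ ^ 2 + C * (1 / 2 : ℝ) ^ n) Filter.atTop
      (nhds (48 * ‖B‖ ^ 2 + C * 0)) :=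
    ((tendsto_pow_atTop_nhds_zero_of_lt_one (by norm_num) (by norm_num)).const_mul C).const_add _
  rw [mul_zero, add_zero] at hl
  exact ge_of_tendsto' hl fun n => hn n ι f hf

/-- The little Grothendieck theorem: operators from `ℓ∞(Γ)` to a Hilbert space are two-summing, with
a bound depending only on the norm. Projecting to the span of the finitely many values at hand
reduces it to finite rank. -/
theorem isTwoSummingBound_linfty {𝕜 Γ H : Type*} [RCLike 𝕜]
    [NormedAddCommGroup H] [InnerProductSpace 𝕜 H]
    (B : lp (fun _ : Γ => 𝕜) ⊤ →L[𝕜] H) : IsTwoSummingBound B (48 * ‖B‖ ^ 2) := by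
  intro ι _ f hf
  let V : Submodule 𝕜 H := Submodule.span 𝕜 (Set.range fun i => B (f i))
  have : FiniteDimensional 𝕜 V := FiniteDimensional.span_of_finite 𝕜 (Set.finite_range _)
  have key := isTwoSummingBound_of_exists
    (isTwoSummingBound_of_finiteDimensional (V.orthogonalProjectionOnto.comp B)) ι f hf
  have e : ∀ i, ‖(V.orthogonalProjectionOnto.comp B) (f i)‖ = ‖B (f i)‖ := by
    intro i
    have hm : B (f i) ∈ V := Submodule.subset_span ⟨i, rfl⟩
    have := V.orthogonalProjectionOnto_mem_subspace_eq_self ⟨B (f i), hm⟩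
    rw [ContinuousLinearMap.comp_apply, this]
    rfl
  simp only [e] at key
  refine key.trans ?_
  have : ‖V.orthogonalProjectionOnto.comp B‖ ≤ ‖B‖ :=
    (ContinuousLinearMap.opNorm_comp_le _ _).trans
      (mul_le_of_le_one_left (norm_nonneg _) V.orthogonalProjectionOnto_norm_le)
  gcongr

/-! ### From extensions to the Hilbert–Schmidt property -/

theorem countable_of_orthonormal {𝕜 E ι : Type*} [RCLike 𝕜] [NormedAddCommGroup E]
    [InnerProductSpace 𝕜 E] [TopologicalSpace.SeparableSpace E] {b : ι → E}
    (hb : Orthonormal 𝕜 b) : Countable ι := by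
  refine Pairwise.countable_of_isOpen_disjoint (s := fun i => Metric.ball (b i) (1 / 2)) ?_
    (fun i => Metric.isOpen_ball) (fun i => Metric.nonempty_ball.2 (by norm_num))
  intro i j hij
  refine Metric.ball_disjoint_ball ?_
  have h : dist (b i) (b j) ^ 2 = 2 := by
    rw [dist_eq_norm, norm_sub_sq (𝕜 := 𝕜), hb.1, hb.1, hb.2 hij]
    norm_num
  nlinarith [dist_nonneg (x := b i) (y := b j)]

theorem hilbertBasis_lp_apply {𝕜 ι : Type*} [RCLike 𝕜] [DecidableEq ι] (i : ι) :
    HilbertBasis.ofRepr (LinearIsometryEquiv.refl 𝕜 (lp (fun _ : ι => 𝕜) 2)) i =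
      lp.single 2 i (1 : 𝕜) := by
  rw [← HilbertBasis.repr_symm_single]
  rfl

theorem orthonormal_lp_single {𝕜 ι : Type*} [RCLike 𝕜] [DecidableEq ι] :
    Orthonormal 𝕜 (fun i : ι => (lp.single 2 i (1 : 𝕜) : lp (fun _ : ι => 𝕜) 2)) := by
  simpa only [funext (hilbertBasis_lp_apply (𝕜 := 𝕜) (ι := ι))] using (HilbertBasis.ofRepr
    (LinearIsometryEquiv.refl 𝕜 (lp (fun _ : ι => 𝕜) 2))).orthonormal

theorem exists_linearIsometry_lp_nat {𝕜 E : Type*} [RCLike 𝕜] [NormedAddCommGroup E]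
    [InnerProductSpace 𝕜 E] [CompleteSpace E] [TopologicalSpace.SeparableSpace E] :
    Nonempty (E →ₗᵢ[𝕜] lp (fun _ : ℕ => 𝕜) 2) := by
  obtain ⟨w, b, -⟩ := exists_hilbertBasis 𝕜 E
  have : Countable w := countable_of_orthonormal b.orthonormal
  obtain ⟨e, he⟩ := exists_injective_nat w
  have ho := (orthonormal_lp_single (𝕜 := 𝕜) (ι := ℕ)).comp e he
  exact ⟨ho.orthogonalFamily.linearIsometry.comp b.repr.toLinearIsometry⟩

/-- Operators into `ℓ₂` see the norms of any countable set of vectors of a Hilbert space: project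
onto their closed span, which is separable. -/
theorem exists_continuousLinearMap_lp_nat {𝕜 H : Type*} [RCLike 𝕜] [NormedAddCommGroup H]
    [InnerProductSpace 𝕜 H] [CompleteSpace H] {s : Set H} (hs : s.Countable) :
    ∃ Q : H →L[𝕜] lp (fun _ : ℕ => 𝕜) 2, ∀ x ∈ s, ‖Q x‖ = ‖x‖ := by
  let K : Submodule 𝕜 H := (Submodule.span 𝕜 s).topologicalClosure
  have hK : TopologicalSpace.IsSeparable (K : Set H) := by
    exact (hs.isSeparable.span (R := 𝕜)).closure
  have : TopologicalSpace.SeparableSpace K := hK.separableSpace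
  have : CompleteSpace K := (Submodule.isClosed_topologicalClosure _).completeSpace_coe
  obtain ⟨U⟩ := exists_linearIsometry_lp_nat (𝕜 := 𝕜) (E := K)
  refine ⟨U.toContinuousLinearMap.comp K.orthogonalProjectionOnto, fun x hx => ?_⟩
  have hm : x ∈ K := Submodule.le_topologicalClosure _ (Submodule.subset_span hx)
  have h := K.orthogonalProjectionOnto_mem_subspace_eq_self ⟨x, hm⟩
  rw [ContinuousLinearMap.comp_apply, h]
  exact U.norm_map _

/-- Each normed space embeds isometrically into a space `ℓ∞`, by norming functionals. The index type
is lifted to reach the universe of the superspaces. -/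
theorem exists_linearIsometry_linfty {𝕜 : Type} [RCLike 𝕜] (X : Type u) [NormedAddCommGroup X]
    [NormedSpace 𝕜 X] : Nonempty (X →ₗᵢ[𝕜] lp (fun _ : ULift.{t} X => 𝕜) ⊤) := by
  have h : ∀ x : X, ∃ φ : X →L[𝕜] 𝕜, ‖φ‖ ≤ 1 ∧ φ x = (‖x‖ : 𝕜) :=
    fun x => exists_dual_vector'' 𝕜 x
  choose φ hφ hφx using h
  have hle : ∀ x y, ‖φ y x‖ ≤ ‖x‖ := fun x y => by
    simpa using (φ y).le_of_opNorm_le (hφ y) x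
  refine ⟨⟨⟨⟨fun x => ⟨fun y => φ y.down x, memℓp_infty ⟨‖x‖, ?_⟩⟩, ?_⟩, ?_⟩, ?_⟩⟩
  · rintro _ ⟨y, rfl⟩
    exact hle x y.down
  · intro x y
    ext z
    exact map_add (φ z.down) x y
  · intro c x
    ext z
    exact map_smul (φ z.down) c x
  · intro x
    refine le_antisymm (lp.norm_le_of_forall_le (norm_nonneg _) fun y => hle x y.down) ?_
    have := lp.norm_apply_le_norm (E := fun _ : ULift.{t} X => 𝕜) (p := ⊤) (by simp)
      ⟨fun y => φ y.down x, memℓp_infty ⟨‖x‖, by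
        rintro _ ⟨y, rfl⟩
        exact hle x y.down⟩⟩ (ULift.up x)
    refine le_trans ?_ this
    simp [hφx]

theorem Orthonormal.norm_sum_smul_sq_le {𝕜 H X ι : Type*} [RCLike 𝕜] [NormedAddCommGroup H]
    [InnerProductSpace 𝕜 H] [SeminormedAddCommGroup X] [NormedSpace 𝕜 X] {b : ι → H}
    (hb : Orthonormal 𝕜 b) (A : H →L[𝕜] X) (s : Finset ι) (a : ι → 𝕜) :
    ‖∑ i ∈ s, a i • A (b i)‖ ^ 2 ≤ ‖A‖ ^ 2 * ∑ i ∈ s, ‖a i‖ ^ 2 := by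
  have h : ‖∑ i ∈ s, a i • b i‖ ^ 2 = ∑ i ∈ s, ‖a i‖ ^ 2 := by
    simpa using hb.orthogonalFamily.norm_sum a s
  rw [← h, ← mul_pow]
  gcongr
  simpa using A.le_opNorm (∑ i ∈ s, a i • b i)

/-- An operator between Hilbert spaces that factors over `ℓ∞(Γ)` is Hilbert–Schmidt. -/
theorem Orthonormal.sum_norm_sq_le_of_linfty {𝕜 Γ H F ι : Type*} [RCLike 𝕜]
    [NormedAddCommGroup H] [InnerProductSpace 𝕜 H] [NormedAddCommGroup F] [InnerProductSpace 𝕜 F]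
    {b : ι → H} (hb : Orthonormal 𝕜 b) (A : H →L[𝕜] lp (fun _ : Γ => 𝕜) ⊤)
    (B : lp (fun _ : Γ => 𝕜) ⊤ →L[𝕜] F) (s : Finset ι) :
    ∑ i ∈ s, ‖B (A (b i))‖ ^ 2 ≤ 48 * ‖B‖ ^ 2 * ‖A‖ ^ 2 := by
  rcases eq_or_ne A 0 with rfl | hA
  · simp
  have hA0 : 0 < ‖A‖ := norm_pos_iff.2 hA
  let c : 𝕜 := ((‖A‖⁻¹ : ℝ) : 𝕜)
  have hc : ‖c‖ ^ 2 = (‖A‖ ^ 2)⁻¹ := by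
    rw [RCLike.norm_ofReal, sq_abs, inv_pow]
  let e : Fin s.card ≃ s := s.equivFin.symm
  have h := isTwoSummingBound_linfty B (Fin s.card) (fun k => c • A (b (e k))) fun γ => by
    have h1 := sum_norm_sq_apply_le s (fun i => A (b i)) (sq_nonneg ‖A‖)
      (hb.norm_sum_smul_sq_le A s) (lp.evalCLM 𝕜 (fun _ : Γ => 𝕜) ⊤ γ)
    have hev : ‖lp.evalCLM 𝕜 (fun _ : Γ => 𝕜) ⊤ γ‖ ≤ 1 :=
      ContinuousLinearMap.opNorm_le_bound _ zero_le_one fun x => by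
        rw [one_mul]
        exact lp.norm_apply_le_norm (by simp) x γ
    have h3 : ∑ i ∈ s, ‖A (b i) γ‖ ^ 2 ≤ ‖A‖ ^ 2 :=
      h1.trans (mul_le_of_le_one_left (sq_nonneg _) (pow_le_one₀ (norm_nonneg _) hev))
    have h4 : ∀ k, ‖(c • A (b (e k)) : lp (fun _ : Γ => 𝕜) ⊤) γ‖ ^ 2 =
        (‖A‖ ^ 2)⁻¹ * ‖A (b (e k)) γ‖ ^ 2 := fun k => by
      rw [← hc, ← mul_pow, ← norm_mul]
      rfl
    simp only [h4]
    rw [Equiv.sum_comp e (fun i : s => (‖A‖ ^ 2)⁻¹ * ‖A (b i) γ‖ ^ 2), ← Finset.mul_sum,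
      Finset.sum_coe_sort s (fun i => ‖A (b i) γ‖ ^ 2), inv_mul_le_iff₀ (by positivity), mul_one]
    exact h3
  have h2 : ∑ k, ‖B (c • A (b (e k)))‖ ^ 2 = (‖A‖ ^ 2)⁻¹ * ∑ i ∈ s, ‖B (A (b i))‖ ^ 2 := by
    simp only [map_smul, norm_smul, mul_pow, hc]
    rw [Equiv.sum_comp e (fun i : s => (‖A‖ ^ 2)⁻¹ * ‖B (A (b i))‖ ^ 2), ← Finset.mul_sum,
      Finset.sum_coe_sort s (fun i => ‖B (A (b i))‖ ^ 2)]
  rw [h2, inv_mul_le_iff₀ (by positivity)] at h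
  linarith

/-- If `B ∘ A` were not Hilbert–Schmidt, countably many basis vectors would witness it. Their images
are seen by an operator `Q` into `ℓ₂`, and `Q ∘ B` extends to a space `ℓ∞` containing `X`, which
bounds the sum. -/
theorem ExtendsToSuperspaces.isHilbertSchmidtSpace {𝕜 : Type} [RCLike 𝕜] {X : Type u}
    [NormedAddCommGroup X] [NormedSpace 𝕜 X]
    (hX : ExtendsToSuperspaces.{u, 0, t} 𝕜 X (lp (fun _ : ℕ => 𝕜) 2)) :
    IsHilbertSchmidtSpace.{u, v, w} 𝕜 X := by
  rintro H₁ H₂ _ _ _ _ _ _ T ⟨A, B, rfl⟩ ι b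
  by_contra hns
  have hF : ∀ n : ℕ, ∃ F : Finset ι, (n : ℝ) < ∑ i ∈ F, ‖B (A (b i))‖ ^ 2 := by
    by_contra! hcon
    obtain ⟨n, hn⟩ := hcon
    exact hns (summable_of_sum_le (fun _ => by positivity) hn)
  choose F hF using hF
  -- The sums over the finite sets `F n` are unbounded.
  obtain ⟨Q, hQ⟩ := exists_continuousLinearMap_lp_nat (𝕜 := 𝕜)
    (s := ⋃ n, (fun i => B (A (b i))) '' (F n))
    (Set.countable_iUnion fun n => ((F n).finite_toSet.image _).countable)
  obtain ⟨j⟩ := exists_linearIsometry_linfty.{u, t} (𝕜 := 𝕜) X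
  obtain ⟨S, hS⟩ := hX (Q.comp B) _ j
  obtain ⟨n, hn⟩ := exists_nat_ge (48 * ‖S‖ ^ 2 * ‖j.toContinuousLinearMap.comp A‖ ^ 2)
  have h1 := b.orthonormal.sum_norm_sq_le_of_linfty (j.toContinuousLinearMap.comp A) S (F n)
  refine (hF n).not_ge (le_trans (Finset.sum_le_sum fun i hi => ?_) (h1.trans hn))
  have h2 : S ((j.toContinuousLinearMap.comp A) (b i)) = Q (B (A (b i))) := hS (A (b i))
  rw [h2, hQ _ (Set.mem_iUnion.2 ⟨n, i, hi, rfl⟩)]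

/-! ### Hilbertian seminorms and extension of two-summing operators -/

/-- A positive semidefinite inner product is realized in a Hilbert space: complete the space for its
seminorm. -/
theorem exists_linearMap_hilbert_of_core {𝕜 : Type*} {Z : Type u} [RCLike 𝕜] [AddCommGroup Z]
    [Module 𝕜 Z] (c : PreInnerProductSpace.Core 𝕜 Z) :
    ∃ (G : Type u) (_ : NormedAddCommGroup G) (_ : InnerProductSpace 𝕜 G) (_ : CompleteSpace G)
      (e : Z →ₗ[𝕜] G), ∀ z, ‖e z‖ ^ 2 = RCLike.re (c.inner z z) := by
  let : SeminormedAddCommGroup Z := InnerProductSpace.Core.toSeminormedAddCommGroup (c := c)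
  let : InnerProductSpace 𝕜 Z := InnerProductSpace.ofCore c
  refine ⟨UniformSpace.Completion Z, inferInstance, inferInstance, inferInstance,
    UniformSpace.Completion.toComplₗᵢ.toLinearMap, fun z => ?_⟩
  have : ‖(UniformSpace.Completion.toComplₗᵢ (𝕜 := 𝕜) (E := Z)) z‖ = ‖z‖ :=
    LinearIsometry.norm_map _ _
  rw [LinearIsometry.coe_toLinearMap, this, ← inner_self_eq_norm_sq (𝕜 := 𝕜)]

/-- An operator dominated by a map into a Hilbert space `G` that is defined on all of `Y` extends to
`Y`: it factors through the closure of the image of `X` in `G`, onto which one can project. -/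
theorem exists_extension_of_le_hilbert {𝕜 X Y G F : Type*} [RCLike 𝕜]
    [NormedAddCommGroup X] [NormedSpace 𝕜 X] [NormedAddCommGroup Y] [NormedSpace 𝕜 Y]
    [NormedAddCommGroup G] [InnerProductSpace 𝕜 G] [CompleteSpace G]
    [NormedAddCommGroup F] [NormedSpace 𝕜 F] [CompleteSpace F]
    (T : X →L[𝕜] F) (j : X →ₗ[𝕜] Y) (e : Y →L[𝕜] G) (C : ℝ)
    (h : ∀ x, ‖T x‖ ≤ C * ‖e (j x)‖) : ∃ S : Y →L[𝕜] F, ∀ x, S (j x) = T x := by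
  let f : X →ₗ[𝕜] G := e.toLinearMap.comp j
  let M : Submodule 𝕜 G := (LinearMap.range f).topologicalClosure
  have : CompleteSpace M := (Submodule.isClosed_topologicalClosure _).completeSpace_coe
  have hM : ∀ x, f x ∈ M := fun x => Submodule.le_topologicalClosure _ ⟨x, rfl⟩
  let p : X →ₗ[𝕜] M := f.codRestrict M hM
  have hp : DenseRange p := by
    intro m
    rw [closure_subtype]
    have : (Subtype.val '' Set.range p : Set G) = Set.range f := by
      rw [← Set.range_comp]
      rfl
    rw [this]
    exact m.2
  refine ⟨((T.toLinearMap.extendOfNorm p).comp M.orthogonalProjectionOnto).comp e, fun x => ?_⟩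
  have hx := M.orthogonalProjectionOnto_mem_subspace_eq_self (p x)
  have h1 : M.orthogonalProjectionOnto (e (j x)) = p x := hx
  rw [ContinuousLinearMap.comp_apply, ContinuousLinearMap.comp_apply, h1]
  exact LinearMap.extendOfNorm_eq hp ⟨C, h⟩ x

/-- The closed unit ball of the dual of `Y`. The functions `φ ↦ φ y` are bounded
on it, and continuous for its norm topology; compactness is not needed. -/
abbrev DualBall (𝕜 Y : Type*) [RCLike 𝕜] [NormedAddCommGroup Y] [NormedSpace 𝕜 Y] : Type _ :=
  Metric.closedBall (0 : Y →L[𝕜] 𝕜) 1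

section
open BoundedContinuousFunction

variable {𝕜 Y : Type*} [RCLike 𝕜] [NormedAddCommGroup Y] [NormedSpace 𝕜 Y]

theorem DualBall.norm_apply_le (φ : DualBall 𝕜 Y) (y : Y) : ‖φ.1 y‖ ≤ ‖y‖ := by
  simpa using φ.1.le_of_opNorm_le (mem_closedBall_zero_iff.1 φ.2) y

theorem DualBall.norm_conj_mul_le (x y : Y) (φ : DualBall 𝕜 Y) :
    ‖(starRingEnd 𝕜) (φ.1 x) * φ.1 y‖ ≤ ‖x‖ * ‖y‖ := by
  rw [norm_mul, RCLike.norm_conj]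
  gcongr <;> exact DualBall.norm_apply_le _ _

/-- The function `φ ↦ re (conj (φ x) * φ y)` on the dual ball. -/
noncomputable def reProd (x y : Y) : DualBall 𝕜 Y →ᵇ ℝ :=
  ofNormedAddCommGroup (fun φ => RCLike.re ((starRingEnd 𝕜) (φ.1 x) * φ.1 y)) (by
      have h : ∀ y : Y, Continuous fun φ : DualBall 𝕜 Y => φ.1 y := fun y =>
        (ContinuousLinearMap.apply 𝕜 𝕜 y).continuous.comp continuous_subtype_val
      exact RCLike.continuous_re.comp ((RCLike.continuous_conj.comp (h x)).mul (h y)))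
    (‖x‖ * ‖y‖) fun φ => (RCLike.norm_re_le_norm _).trans (DualBall.norm_conj_mul_le x y φ)

/-- The function `φ ↦ im (conj (φ x) * φ y)` on the dual ball. -/
noncomputable def imProd (x y : Y) : DualBall 𝕜 Y →ᵇ ℝ :=
  ofNormedAddCommGroup (fun φ => RCLike.im ((starRingEnd 𝕜) (φ.1 x) * φ.1 y)) (by
      have h : ∀ y : Y, Continuous fun φ : DualBall 𝕜 Y => φ.1 y := fun y =>
        (ContinuousLinearMap.apply 𝕜 𝕜 y).continuous.comp continuous_subtype_val
      exact RCLike.continuous_im.comp ((RCLike.continuous_conj.comp (h x)).mul (h y)))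
    (‖x‖ * ‖y‖) fun φ => (RCLike.norm_im_le_norm _).trans (DualBall.norm_conj_mul_le x y φ)

theorem reProd_apply (x y : Y) (φ : DualBall 𝕜 Y) :
    reProd x y φ = RCLike.re ((starRingEnd 𝕜) (φ.1 x) * φ.1 y) := rfl

theorem imProd_apply (x y : Y) (φ : DualBall 𝕜 Y) :
    imProd x y φ = RCLike.im ((starRingEnd 𝕜) (φ.1 x) * φ.1 y) := rfl

theorem reProd_self_apply (x : Y) (φ : DualBall 𝕜 Y) :
    reProd x x φ = ‖φ.1 x‖ ^ 2 := by
  rw [reProd_apply, RCLike.conj_mul]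
  norm_cast

/-- A positive functional `μ` on bounded functions on the dual ball plays the role of a measure: it
gives the semi-inner product `∫ conj (φ x) * φ y ∂μ(φ)` on `Y`. -/
theorem exists_core_of_positive (μ : (DualBall 𝕜 Y →ᵇ ℝ) →ₗ[ℝ] ℝ)
    (hμ : ∀ f, 0 ≤ f → 0 ≤ μ f) :
    ∃ c : PreInnerProductSpace.Core 𝕜 Y, ∀ y, RCLike.re (c.inner y y) = μ (reProd y y) := by
  -- Over the reals `I = 0`, but then `imProd` vanishes.
  have hI : ∀ x y : Y, μ (imProd x y) * RCLike.im (RCLike.I : 𝕜) = μ (imProd x y) := fun x y => by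
    rw [mul_comm, ← smul_eq_mul, ← map_smul]
    congr 1
    ext φ
    simp only [coe_smul, imProd_apply, smul_eq_mul]
    rw [mul_comm, RCLike.I_im]
  have hre : ∀ x y : Y, RCLike.re ((μ (reProd x y) : 𝕜) + (μ (imProd x y) : 𝕜) * RCLike.I) =
      μ (reProd x y) := fun x y => by simp
  have him : ∀ x y : Y, RCLike.im ((μ (reProd x y) : 𝕜) + (μ (imProd x y) : 𝕜) * RCLike.I) =
      μ (imProd x y) := fun x y => by simp [hI]
  refine ⟨
    { inner x y := (μ (reProd x y) : 𝕜) + (μ (imProd x y) : 𝕜) * RCLike.I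
      conj_inner_symm x y := by
        apply RCLike.ext
        · rw [RCLike.conj_re, hre, hre]
          congr 1
          ext φ
          simp [reProd_apply]
          ring
        · rw [RCLike.conj_im, him, him, ← map_neg]
          congr 1
          ext φ
          simp [imProd_apply]
          ring
      re_inner_nonneg x := by
        rw [hre]
        refine hμ _ fun φ => ?_
        exact (sq_nonneg ‖φ.1 x‖).trans_eq (reProd_self_apply x φ).symm
      add_left x y z := by
        apply RCLike.ext
        · rw [map_add RCLike.re (_ + _ * _) (_ + _ * _), hre, hre, hre, ← map_add]
          congr 1
          ext φ
          simp [reProd_apply]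
          ring
        · rw [map_add RCLike.im (_ + _ * _) (_ + _ * _), him, him, him, ← map_add]
          congr 1
          ext φ
          simp [imProd_apply]
          ring
      smul_left x y r := by
        apply RCLike.ext
        · rw [RCLike.mul_re, hre, hre, him, RCLike.conj_re, RCLike.conj_im, ← smul_eq_mul,
            ← smul_eq_mul, ← map_smul, ← map_smul, ← map_sub]
          congr 1
          ext φ
          simp [reProd_apply, imProd_apply]
          ring
        · rw [RCLike.mul_im, hre, him, him, RCLike.conj_re, RCLike.conj_im, ← smul_eq_mul,
            ← smul_eq_mul, ← map_smul, ← map_smul, ← map_add]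
          congr 1
          ext φ
          simp [reProd_apply, imProd_apply]
          ring }, fun y => hre y y⟩

/-- `T` is two-summing, and `C` bounds the square of its two-summing norm. The weak `ℓ₂`-norm of the
family `x` is expressed as the norm of the operator `a ↦ ∑ i, a i • x i` on `ℓ₂`. -/
def IsTwoSumming {X F : Type*} [NormedAddCommGroup X] [NormedSpace 𝕜 X]
    [NormedAddCommGroup F] [NormedSpace 𝕜 F] (T : X →L[𝕜] F) (C : ℝ) : Prop :=
  ∀ (ι : Type) [Fintype ι] (x : ι → X) (K : ℝ), 0 ≤ K →
    (∀ a : ι → 𝕜, ‖∑ i, a i • x i‖ ^ 2 ≤ K * ∑ i, ‖a i‖ ^ 2) → ∑ i, ‖T (x i)‖ ^ 2 ≤ C * K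

theorem norm_sum_smul_sq_le_of_dualBall {ι : Type*} [Fintype ι] (y : ι → Y) {K : ℝ}
    (hy : ∀ φ : DualBall 𝕜 Y, ∑ i, ‖φ.1 (y i)‖ ^ 2 ≤ K) (a : ι → 𝕜) :
    ‖∑ i, a i • y i‖ ^ 2 ≤ K * ∑ i, ‖a i‖ ^ 2 := by
  obtain ⟨φ, hφ, hφy⟩ := exists_dual_vector'' 𝕜 (∑ i, a i • y i)
  have h1 : ‖∑ i, a i • y i‖ = ‖∑ i, a i * φ (y i)‖ := by
    have : φ (∑ i, a i • y i) = ∑ i, a i * φ (y i) := by simp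
    rw [← this, hφy]
    simp
  rw [h1]
  exact norm_sum_mul_sq_le _ a (fun i => φ (y i)) (hy ⟨φ, mem_closedBall_zero_iff.2 hφ⟩)

/-- The functions on the dual ball that are at least a finite sum of functions
`φ ↦ C * ‖φ (j x)‖ ^ 2 - ‖T x‖ ^ 2`. A functional nonnegative on this cone is positive and
dominates `T`. -/
noncomputable def dominationCone {X F : Type*} [NormedAddCommGroup X] [NormedSpace 𝕜 X]
    [NormedAddCommGroup F] [NormedSpace 𝕜 F] (T : X →L[𝕜] F) (j : X →ₗᵢ[𝕜] Y) (C : ℝ) :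
    PointedCone ℝ (DualBall 𝕜 Y →ᵇ ℝ) where
  carrier := {f | ∃ (ι : Type) (_ : Fintype ι) (x : ι → X),
    ∀ φ, ∑ i, (C * ‖φ.1 (j (x i))‖ ^ 2 - ‖T (x i)‖ ^ 2) ≤ f φ}
  add_mem' := by
    rintro f g ⟨ι, _, x, hx⟩ ⟨κ, _, y, hy⟩
    refine ⟨ι ⊕ κ, inferInstance, Sum.elim x y, fun φ => ?_⟩
    rw [Fintype.sum_sum_type]
    exact add_le_add (hx φ) (hy φ)
  zero_mem' := ⟨Fin 0, inferInstance, Fin.elim0, fun φ => by simp⟩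
  smul_mem' := by
    rintro ⟨c, hc⟩ f ⟨ι, _, x, hx⟩
    refine ⟨ι, inferInstance, fun i => ((√c : ℝ) : 𝕜) • x i, fun φ => ?_⟩
    have h : ∀ i, C * ‖φ.1 (j (((√c : ℝ) : 𝕜) • x i))‖ ^ 2 - ‖T (((√c : ℝ) : 𝕜) • x i)‖ ^ 2 =
        c * (C * ‖φ.1 (j (x i))‖ ^ 2 - ‖T (x i)‖ ^ 2) := fun i => by
      simp only [map_smul, norm_smul, mul_pow, RCLike.norm_ofReal, sq_abs, Real.sq_sqrt hc]
      ring
    simp only [h, ← Finset.mul_sum]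
    exact mul_le_mul_of_nonneg_left (hx φ) hc

/-- Pietsch domination. A finitely additive probability on the dual ball is enough, and it comes from
the M. Riesz extension theorem: that the two-summing bound holds means that a constant in
`dominationCone` is nonnegative. -/
theorem IsTwoSumming.exists_positive_functional {X F : Type*} [NormedAddCommGroup X]
    [NormedSpace 𝕜 X] [NormedAddCommGroup F] [NormedSpace 𝕜 F] {T : X →L[𝕜] F} {C : ℝ}
    (hC : 0 < C) (hT : IsTwoSumming T C) (j : X →ₗᵢ[𝕜] Y) :
    ∃ μ : (DualBall 𝕜 Y →ᵇ ℝ) →ₗ[ℝ] ℝ, (∀ f, 0 ≤ f → 0 ≤ μ f) ∧ μ 1 = 1 ∧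
      ∀ x, ‖T x‖ ^ 2 ≤ C * μ (reProd (j x) (j x)) := by
  let z : DualBall 𝕜 Y := ⟨0, by simp⟩
  have h1 : (1 : DualBall 𝕜 Y →ᵇ ℝ) ≠ 0 := fun h => by
    simpa using DFunLike.congr_fun h z
  let p : (DualBall 𝕜 Y →ᵇ ℝ) →ₗ.[ℝ] ℝ := LinearPMap.mkSpanSingleton 1 1 h1
  have hpos : ∀ f, 0 ≤ f → f ∈ dominationCone T j C := fun f hf =>
    ⟨Fin 0, inferInstance, Fin.elim0, fun φ => by simpa using hf φ⟩
  obtain ⟨μ, hμ, hμs⟩ := riesz_extension (dominationCone T j C) p (by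
    rintro ⟨f, hf⟩ hfs
    obtain ⟨c, rfl⟩ := Submodule.mem_span_singleton.1 hf
    have e : p ⟨c • 1, hf⟩ = c := by
      refine (LinearPMap.mkSpanSingleton'_apply _ _ _ _ _).trans ?_
      simp
    rw [e]
    obtain ⟨ι, _, x, hx⟩ := hfs
    have hx' : ∀ φ : DualBall 𝕜 Y, ∑ i, ‖φ.1 (j (x i))‖ ^ 2 ≤ (c + ∑ i, ‖T (x i)‖ ^ 2) / C := by
      intro φ
      have := hx φ
      rw [Finset.sum_sub_distrib, ← Finset.mul_sum] at this
      rw [le_div_iff₀' hC]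
      have e1 : (c • (1 : DualBall 𝕜 Y →ᵇ ℝ)) φ = c := by simp
      rw [e1] at this
      linarith
    have hK : 0 ≤ (c + ∑ i, ‖T (x i)‖ ^ 2) / C := (Finset.sum_nonneg fun _ _ => sq_nonneg _).trans (hx' z)
    have h2 := hT ι x _ hK fun a => by
      have := norm_sum_smul_sq_le_of_dualBall (fun i => j (x i)) hx' a
      have e2 : ∑ i, a i • j (x i) = j (∑ i, a i • x i) := by simp
      rwa [e2, j.norm_map] at this
    rw [mul_div_cancel₀ _ hC.ne'] at h2
    linarith) (by
    intro f
    refine ⟨⟨‖f‖ • 1, Submodule.mem_span_singleton.2 ⟨_, rfl⟩⟩, hpos _ fun φ => ?_⟩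
    have := neg_le_of_abs_le (f.norm_coe_le_norm φ)
    simp
    linarith)
  refine ⟨μ, fun f hf => hμs f (hpos f hf), ?_, fun x => ?_⟩
  · have := hμ ⟨1, Submodule.mem_span_singleton_self _⟩
    rw [this]
    exact LinearPMap.mkSpanSingleton'_apply_self _ _ _ _
  · have h2 : C • reProd (j x) (j x) - ‖T x‖ ^ 2 • (1 : DualBall 𝕜 Y →ᵇ ℝ) ∈
        dominationCone T j C :=
      ⟨Fin 1, inferInstance, fun _ => x, fun φ => by simp [reProd_self_apply]⟩
    have h3 := hμs _ h2
    have h4 : μ 1 = 1 := by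
      rw [hμ ⟨1, Submodule.mem_span_singleton_self _⟩]
      exact LinearPMap.mkSpanSingleton'_apply_self _ _ _ _
    simp only [map_sub, map_smul, h4, smul_eq_mul] at h3
    linarith

theorem IsTwoSumming.exists_extension {X F : Type*} [NormedAddCommGroup X]
    [NormedSpace 𝕜 X] [NormedAddCommGroup F] [NormedSpace 𝕜 F] [CompleteSpace F]
    {T : X →L[𝕜] F} {C : ℝ} (hC : 0 < C) (hT : IsTwoSumming T C) (j : X →ₗᵢ[𝕜] Y) :
    ∃ S : Y →L[𝕜] F, ∀ x, S (j x) = T x := by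
  obtain ⟨μ, hμ, hμ1, hTμ⟩ := hT.exists_positive_functional hC j
  obtain ⟨c, hc⟩ := exists_core_of_positive μ hμ
  obtain ⟨G, _, _, _, e, he⟩ := exists_linearMap_hilbert_of_core c
  simp only [hc] at he
  have hle : ∀ y, ‖e y‖ ≤ 1 * ‖y‖ := fun y => by
    rw [one_mul]
    refine le_of_sq_le_sq ?_ (norm_nonneg _)
    have h : 0 ≤ μ (‖y‖ ^ 2 • 1 - reProd y y) := hμ _ fun φ => by
      have := DualBall.norm_apply_le φ y
      simp [reProd_self_apply]
      gcongr
    rw [map_sub, map_smul, hμ1] at h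
    rw [he]
    simpa using h
  refine exists_extension_of_le_hilbert T j.toLinearMap (e.mkContinuous 1 hle) √C fun x => ?_
  refine le_of_sq_le_sq ?_ (by positivity)
  rw [mul_pow, Real.sq_sqrt hC.le]
  exact (hTμ x).trans_eq (by rw [← he]; rfl)

end

/-! ### Two-summing constants from the Hilbert–Schmidt property -/

/-- `ℓ₂` embeds isometrically into a copy of itself in any given universe. -/
theorem exists_linearIsometry_lp_ulift {𝕜 : Type} [RCLike 𝕜] :
    Nonempty (lp (fun _ : ℕ => 𝕜) 2 →ₗᵢ[𝕜] lp (fun _ : ULift.{w} ℕ => 𝕜) 2) := by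
  classical
  have ho := (orthonormal_lp_single (𝕜 := 𝕜) (ι := ULift.{w} ℕ)).comp ULift.up ULift.up_injective
  exact ⟨ho.orthogonalFamily.linearIsometry⟩

/-- Uniform boundedness: if `T ∘ A` has a finite Hilbert–Schmidt sum for each `A`, these sums are
bounded by a multiple of `‖A‖ ^ 2`. Apply the Banach–Steinhaus theorem to the operators
`A ↦ (T (A (e i)))` truncated to finite sets of indices. -/
theorem exists_bound_of_summable {𝕜 X F ι : Type*} [RCLike 𝕜] [NormedAddCommGroup X]
    [NormedSpace 𝕜 X] [CompleteSpace X] [NormedAddCommGroup F] [NormedSpace 𝕜 F]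
    {H : Type*} [NormedAddCommGroup H] [NormedSpace 𝕜 H]
    (T : X →L[𝕜] F) (e : ι → H)
    (hT : ∀ A : H →L[𝕜] X, Summable fun i => ‖T (A (e i))‖ ^ 2) :
    ∃ C, 0 < C ∧ ∀ (A : H →L[𝕜] X) (s : Finset ι), ∑ i ∈ s, ‖T (A (e i))‖ ^ 2 ≤ C * ‖A‖ ^ 2 := by
  classical
  let g : Finset ι → (H →L[𝕜] X) →L[𝕜] lp (fun _ : ι => F) 2 := fun s =>
    ∑ i ∈ s, ((lp.singleContinuousLinearMap 𝕜 (fun _ : ι => F) 2 i).comp T).comp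
      (ContinuousLinearMap.apply 𝕜 X (e i))
  have hg : ∀ s A, ‖g s A‖ ^ 2 = ∑ i ∈ s, ‖T (A (e i))‖ ^ 2 := fun s A => by
    have h := lp.norm_sum_single (p := 2) (E := fun _ : ι => F) (by norm_num)
      (fun i => T (A (e i))) s
    have h2 : g s A = ∑ i ∈ s, lp.single 2 i (T (A (e i))) := by
      simp only [g, sum_apply]
      rfl
    rw [h2]
    simpa using h
  obtain ⟨C, hC⟩ := banach_steinhaus (g := g) fun A =>
    ⟨√(∑' i, ‖T (A (e i))‖ ^ 2), fun s => by
      refine Real.le_sqrt_of_sq_le ?_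
      rw [hg]
      exact (hT A).sum_le_tsum s fun _ _ => sq_nonneg _⟩
  refine ⟨C ^ 2 + 1, by positivity, fun A s => ?_⟩
  rw [← hg]
  calc ‖g s A‖ ^ 2 ≤ (C * ‖A‖) ^ 2 := by
        gcongr
        exact (g s).le_of_opNorm_le (hC s) A
    _ ≤ _ := by
        rw [mul_pow]
        gcongr
        linarith

/-- Operators from a Hilbert–Schmidt space to `ℓ₂` are two-summing: a finite family with bounded weak
`ℓ₂`-norm is the image of orthonormal vectors under a bounded operator `A` on `ℓ₂`. -/
theorem IsHilbertSchmidtSpace.exists_isTwoSumming {𝕜 : Type} [RCLike 𝕜] {X : Type u}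
    [NormedAddCommGroup X] [NormedSpace 𝕜 X] [CompleteSpace X]
    (hX : IsHilbertSchmidtSpace.{u, v, w} 𝕜 X) (T : X →L[𝕜] lp (fun _ : ℕ => 𝕜) 2) :
    ∃ C, 0 < C ∧ IsTwoSumming T C := by
  classical
  let ι := ULift.{v} ℕ
  let e : ι → lp (fun _ : ι => 𝕜) 2 := fun i => lp.single 2 i (1 : 𝕜)
  obtain ⟨U⟩ := exists_linearIsometry_lp_ulift.{w} (𝕜 := 𝕜)
  obtain ⟨C, hC, h⟩ := exists_bound_of_summable T e fun A => by
    have := hX (lp (fun _ : ι => 𝕜) 2) (lp (fun _ : ULift.{w} ℕ => 𝕜) 2) _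
      ⟨A, U.toContinuousLinearMap.comp T, rfl⟩ ι
      (HilbertBasis.ofRepr (LinearIsometryEquiv.refl 𝕜 _))
    simpa [hilbertBasis_lp_apply] using this
  refine ⟨C, hC, fun κ _ x K hK hx => ?_⟩
  let m : κ ↪ ι :=
    ((Fintype.equivFin κ).toEmbedding.trans Fin.valEmbedding).trans Equiv.ulift.symm.toEmbedding
  let A : lp (fun _ : ι => 𝕜) 2 →L[𝕜] X :=
    ∑ k, (lp.evalCLM 𝕜 (fun _ : ι => 𝕜) 2 (m k)).smulRight (x k)
  have hA : ∀ a, A a = ∑ k, a (m k) • x k := fun a => by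
    simp only [A, sum_apply]
    rfl
  have hAe : ∀ k, A (e (m k)) = x k := fun k => by
    rw [hA, Finset.sum_eq_single k]
    · simp [e]
    · intro l _ hl
      have : m l ≠ m k := fun h => hl (m.injective h)
      simp [e, this]
    · simp
  have hAn : ‖A‖ ≤ √K := A.opNorm_le_bound (Real.sqrt_nonneg _) fun a => by
    refine le_of_sq_le_sq ?_ (by positivity)
    rw [mul_pow, Real.sq_sqrt hK, hA]
    refine (hx _).trans ?_
    gcongr
    have := lp.sum_rpow_le_norm_rpow (p := 2) (by norm_num) a (Finset.univ.map m)
    simpa using this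
  have h1 := h A (Finset.univ.map m)
  rw [Finset.sum_map] at h1
  simp only [hAe] at h1
  refine h1.trans ?_
  gcongr
  calc ‖A‖ ^ 2 ≤ √K ^ 2 := by gcongr
    _ = K := Real.sq_sqrt hK

theorem theorem3p13 {𝕜 : Type} [RCLike 𝕜] (X : Type u)
    [NormedAddCommGroup X] [NormedSpace 𝕜 X] [CompleteSpace X] :
    IsHilbertSchmidtSpace.{u, v, w} 𝕜 X ↔
      ExtendsToSuperspaces.{u, 0, t} 𝕜 X (lp (fun _ : ℕ => 𝕜) 2) := by
  refine ⟨fun hX T Y _ _ _ j => ?_, fun hX => hX.isHilbertSchmidtSpace⟩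
  obtain ⟨C, hC, hT⟩ := hX.exists_isTwoSumming T
  exact hT.exists_extension hC j
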